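/- Let $\Bbbk$ be a field; all categories and functors are $\Bbbk$-linear. Let $\mathcal{C}$ be an abelian monoidal category (with $\Bbbk$-bilinear tensor product) and $\mathcal{M}$ an abelian left $\mathcal{C}$-module category whose action $\triangleright$ is $\Bbbk$-bilinear and right exact (i.e. preserves finite colimits) in each variable. Let $(T,\mu,\eta)$ be a right exact lax $\mathcal{C}$-module monad on $\mathcal{M}$: $T$ is a right exact lax $\mathcal{C}$-module functor, with structure morphisms $T_{a;x,m}\colon x\triangleright Tm\to T(x\triangleright m)$, and $\eta$ and $\mu$ are $\mathcal{C}$-module transformations. Let $\mathcal{M}_T$ be the Kleisli category, with the $\mathcal{C}$-module structure which is $x\triangleright m$ on objects and sends $f\colon m\to Tn$ to $T_{a;x,n}\circ(x\triangleright f)$, let $\mathcal{M}^T$ be the Eilenberg–Moore category, and let $\iota\colon\mathcal{M}_T\to\mathcal{M}^T$, $m\mapsto(Tm,\mu_m)$, $f\mapsto\mu\circ Tf$, be the canonical embedding. (1) Existence. For $x\in\mathcal{C}$ and $(m,\nabla_m)\in\mathcal{M}^T$ the Linton coequaliser $$x\blacktriangleright m=\operatorname{coeq}\Big(T(x\triangleright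 Tm)\ \rightrightarrows\ T(x\triangleright m)\Big)$$ of $T(x\triangleright\nabla_m)$ and $\mu_{x\triangleright m}\circ T(T_{a;x,m})$ exists in $\mathcal{M}^T$. The induced functor $\blacktriangleright$ is $\Bbbk$-bilinear, right exact in the variable in $\mathcal{M}^T$, and is the action functor of a left $\mathcal{C}$-module structure on $\mathcal{M}^T$ whose associator and unitor are induced on coequalisers by those of $\mathcal{M}$. The morphisms $\mu_{x\triangleright m}\circ T(T_{a;x,m})\colon T(x\triangleright Tm)\to T(x\triangleright m)$ induce isomorphisms $x\blacktriangleright\iota m\cong\iota(x\triangleright m)$ which make $\iota$ a strong $\mathcal{C}$-module functor. (2) Essential uniqueness. Given any two left $\mathcal{C}$-module structures on $\mathcal{M}^T$, each right exact in the variable in $\mathcal{M}^T$ and each equipped with a strong $\mathcal{C}$-module functor structure on $\iota$, there is exactly one strong $\mathcal{C}$-module functor structure on the identity functor of $\mathcal{M}^T$, from the first module structure to the second, whose composite with the first structure on $\iota$ is the second structure on $\iota$. In particular the two $\mathcal{C}$-module categories are equivalent. -/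

import Mathlib

open CategoryTheory Limits MonoidalCategory
open scoped CategoryTheory.MonoidalCategory.MonoidalLeftAction

namespace ModuleMonad

open Functor.LaxLeftLinear

section Actions

variable (k : Type*) [Field k] (C : Type*) [Category* C] [Preadditive C] [Linear k C]
  [MonoidalCategory C] (D : Type*) [Category* D] [Preadditive D] [Linear k D]

/-- A left action of `C` on `D` is `k`-bilinear if the action functor is `k`-linear on morphisms
in each variable, that is, if it is a `k`-linear functor `C ⊗ₖ D ⥤ D`. -/
class BilinearAction [MonoidalLeftAction C D] : Prop where
  actionHomLeft_add {c c' : C} (f g : c ⟶ c') (d : D) : (f + g) ⊵ₗ d = f ⊵ₗ d + g ⊵ₗ d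
  actionHomLeft_smul {c c' : C} (r : k) (f : c ⟶ c') (d : D) : (r • f) ⊵ₗ d = r • (f ⊵ₗ d)
  actionHomRight_add (c : C) {d d' : D} (f g : d ⟶ d') : c ⊴ₗ (f + g) = c ⊴ₗ f + c ⊴ₗ g
  actionHomRight_smul (c : C) {d d' : D} (r : k) (f : d ⟶ d') : c ⊴ₗ (r • f) = r • (c ⊴ₗ f)

end Actions

/-- The Eilenberg–Moore category of a `k`-linear monad is `k`-linear. -/
instance algebraLinear (k : Type*) [Field k] {M : Type*} [Category* M] [Preadditive M]
    [Linear k M] (T : Monad M) [T.toFunctor.Additive] [T.toFunctor.Linear k] :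
    Linear k T.Algebra where
  homModule X Y :=
    { smul r f :=
        { f := r • f.f
          h := by simp [Functor.map_smul] }
      one_smul _ := Monad.Algebra.Hom.ext (one_smul _ _)
      mul_smul _ _ _ := Monad.Algebra.Hom.ext (mul_smul _ _ _)
      smul_zero _ := Monad.Algebra.Hom.ext (smul_zero _)
      smul_add _ _ _ := Monad.Algebra.Hom.ext (smul_add _ _ _)
      add_smul _ _ _ := Monad.Algebra.Hom.ext (add_smul _ _ _)
      zero_smul _ := Monad.Algebra.Hom.ext (zero_smul _ _) }
  smul_comp _ _ _ _ _ _ := Monad.Algebra.Hom.ext (Linear.smul_comp _ _ _ _ _ _)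
  comp_smul _ _ _ _ _ _ := Monad.Algebra.Hom.ext (Linear.comp_smul _ _ _ _ _ _)

variable (C : Type*) [Category* C] [MonoidalCategory C]
  {M : Type*} [Category* M] [MonoidalLeftAction C M]

/-- A monad `T` on a `C`-module category whose underlying functor is a lax `C`-module functor is
a lax `C`-module monad if its unit and multiplication are `C`-module transformations. -/
class LaxModuleMonad (T : Monad M) [T.toFunctor.LaxLeftLinear C] : Prop where
  unit_comp (x : C) (m : M) :
    x ⊴ₗ T.η.app m ≫ μₗ T.toFunctor x m = T.η.app (x ⊙ₗ m)
  mul_comp (x : C) (m : M) :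
    x ⊴ₗ T.μ.app m ≫ μₗ T.toFunctor x m =
      μₗ T.toFunctor x (T.obj m) ≫ T.map (μₗ T.toFunctor x m) ≫ T.μ.app (x ⊙ₗ m)

section Embedding

lemma free_hom (T : Monad M) {m n : M} (f : m ⟶ T.obj n) :
    T.map (T.map f ≫ T.μ.app n) ≫ T.μ.app n = T.μ.app m ≫ T.map f ≫ T.μ.app n := by
  rw [Functor.map_comp, Category.assoc, T.assoc, ← Category.assoc, ← Category.assoc]
  congr 1
  exact T.μ.naturality f

/-- The canonical embedding `ι` of the Kleisli category into the Eilenberg–Moore category,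
`m ↦ (T m, μ_m)`. -/
@[simps]
def embedding (T : Monad M) : Kleisli T ⥤ T.Algebra where
  obj m := T.free.obj m.of
  map {m n} f :=
    { f := T.map f.of ≫ T.μ.app n.of
      h := free_hom T f.of }
  map_id m := by
    ext
    exact T.right_unit _
  map_comp {_ _ p} f g := by
    ext
    change T.map (f.of ≫ T.map g.of ≫ T.μ.app p.of) ≫ T.μ.app p.of =
      (T.map f.of ≫ T.μ.app _) ≫ T.map g.of ≫ T.μ.app p.of
    rw [Functor.map_comp, Category.assoc, free_hom, Category.assoc]

end Embedding

variable (T : Monad M) [T.toFunctor.LaxLeftLinear C]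

section KleisliAction

/-- A morphism of `M`, regarded as a morphism of the Kleisli category through the free functor
`F_T : M ⥤ M_T`. -/
def pureHom {a b : M} (f : a ⟶ b) : Kleisli.mk T a ⟶ Kleisli.mk T b :=
  (Kleisli.Adjunction.toKleisli T).map f

/-- An isomorphism of `M`, regarded as an isomorphism of the Kleisli category. -/
@[simps]
def pureIso {a b : M} (f : a ≅ b) : Kleisli.mk T a ≅ Kleisli.mk T b where
  hom := pureHom T f.hom
  inv := pureHom T f.inv
  hom_inv_id := ((Kleisli.Adjunction.toKleisli T).mapIso f).hom_inv_id
  inv_hom_id := ((Kleisli.Adjunction.toKleisli T).mapIso f).inv_hom_id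

lemma pureHom_comp {a b c : M} (f : a ⟶ b) (g : b ⟶ c) :
    pureHom T (f ≫ g) = pureHom T f ≫ pureHom T g :=
  (Kleisli.Adjunction.toKleisli T).map_comp f g

lemma pureHom_comp_left {a b : M} {c : Kleisli T} (f : a ⟶ b) (g : Kleisli.mk T b ⟶ c) :
    pureHom T f ≫ g = Kleisli.Hom.mk (f ≫ g.of) := by
  ext
  change (f ≫ T.η.app b) ≫ T.map g.of ≫ T.μ.app c.of = f ≫ g.of
  have h : T.η.app b ≫ T.map g.of = g.of ≫ T.η.app (T.obj c.of) := (T.η.naturality g.of).symm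
  rw [Category.assoc, reassoc_of% h, T.left_unit]
  exact congrArg (f ≫ ·) (Category.comp_id _)

lemma comp_pureHom {a : Kleisli T} {b c : M} (g : a ⟶ Kleisli.mk T b) (f : b ⟶ c) :
    g ≫ pureHom T f = Kleisli.Hom.mk (g.of ≫ T.map f) := by
  ext
  change g.of ≫ T.map (f ≫ T.η.app c) ≫ T.μ.app c = g.of ≫ T.map f
  rw [Functor.map_comp, Category.assoc, T.right_unit]
  exact congrArg (g.of ≫ ·) (Category.comp_id _)

variable {C}

/-- The action of an object `x` of `C` on a morphism of the Kleisli category. -/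
def kleisliActionHom (x : C) {m n : Kleisli T} (f : m ⟶ n) :
    Kleisli.mk T (x ⊙ₗ m.of) ⟶ Kleisli.mk T (x ⊙ₗ n.of) :=
  Kleisli.Hom.mk (x ⊴ₗ f.of ≫ μₗ T.toFunctor x n.of)

lemma kleisliActionHom_map [LaxModuleMonad C T] (x : C) {m n : M} (f : m ⟶ n) :
    kleisliActionHom T x (pureHom T f) =
      pureHom T (x ⊴ₗ f) := by
  ext
  change x ⊴ₗ (f ≫ T.η.app n) ≫ μₗ T.toFunctor x n = x ⊴ₗ f ≫ T.η.app (x ⊙ₗ n)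
  rw [← LaxModuleMonad.unit_comp, MonoidalLeftAction.actionHomRight_comp, Category.assoc]

lemma kleisliActionHom_comp [LaxModuleMonad C T] (x : C) {m n p : Kleisli T} (f : m ⟶ n)
    (g : n ⟶ p) :
    kleisliActionHom T x (f ≫ g) = kleisliActionHom T x f ≫ kleisliActionHom T x g := by
  ext
  change x ⊴ₗ (f.of ≫ T.map g.of ≫ T.μ.app p.of) ≫ μₗ T.toFunctor x p.of =
    (x ⊴ₗ f.of ≫ μₗ T.toFunctor x n.of) ≫
      T.map (x ⊴ₗ g.of ≫ μₗ T.toFunctor x p.of) ≫ T.μ.app _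
  rw [MonoidalLeftAction.actionHomRight_comp, MonoidalLeftAction.actionHomRight_comp,
    Category.assoc, Category.assoc, LaxModuleMonad.mul_comp, Functor.map_comp, Category.assoc,
    Category.assoc, ← μₗ_naturality_right_assoc]

lemma kleisliActionHom_exchange {x y : C} (f : x ⟶ y) {m n : Kleisli T} (g : m ⟶ n) :
    pureHom T (f ⊵ₗ m.of) ≫ kleisliActionHom T y g =
      kleisliActionHom T x g ≫ pureHom T (f ⊵ₗ n.of) := by
  rw [pureHom_comp_left, comp_pureHom]
  ext
  change f ⊵ₗ m.of ≫ y ⊴ₗ g.of ≫ μₗ T.toFunctor y n.of =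
    (x ⊴ₗ g.of ≫ μₗ T.toFunctor x n.of) ≫ T.map (f ⊵ₗ n.of)
  rw [Category.assoc, ← μₗ_naturality_left, ← MonoidalLeftAction.action_exchange_assoc]

lemma kleisliActionHom_tensor (x y : C) {m n : Kleisli T} (g : m ⟶ n) :
    kleisliActionHom T (x ⊗ y) g ≫ pureHom T (αₗ x y n.of).hom =
      pureHom T (αₗ x y m.of).hom ≫
        kleisliActionHom T x (kleisliActionHom T y g) := by
  rw [pureHom_comp_left, comp_pureHom]
  ext
  change ((x ⊗ y) ⊴ₗ g.of ≫ μₗ T.toFunctor (x ⊗ y) n.of) ≫ T.map (αₗ x y n.of).hom =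
    (αₗ x y m.of).hom ≫ x ⊴ₗ (y ⊴ₗ g.of ≫ μₗ T.toFunctor y n.of) ≫ μₗ T.toFunctor x (y ⊙ₗ n.of)
  simp

lemma kleisliActionHom_unit {m n : Kleisli T} (g : m ⟶ n) :
    kleisliActionHom T (𝟙_ C) g ≫ pureHom T (λₗ n.of).hom =
      pureHom T (λₗ m.of).hom ≫ g := by
  rw [pureHom_comp_left, comp_pureHom]
  ext
  change ((𝟙_ C) ⊴ₗ g.of ≫ μₗ T.toFunctor (𝟙_ C) n.of) ≫ T.map (λₗ n.of).hom =
    (λₗ m.of).hom ≫ g.of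
  rw [Category.assoc, ← μₗ_unitality, MonoidalLeftAction.actionUnitIso_hom_naturality]

variable (C)

/-- The `C`-module structure on the Kleisli category of a lax `C`-module monad: it is that of `M`
on objects, and `x` acts on `f : m ⟶ T n` by `x ▷ m ⟶ x ▷ T n ⟶ T (x ▷ n)`. -/
instance kleisliAction [LaxModuleMonad C T] : MonoidalLeftAction C (Kleisli T) where
  actionObj x m := Kleisli.mk T (x ⊙ₗ m.of)
  actionHomLeft f m := pureHom T (f ⊵ₗ m.of)
  actionHomRight x _ _ f := kleisliActionHom T x f
  actionAssocIso x y m := pureIso T (αₗ x y m.of)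
  actionUnitIso m := pureIso T (λₗ m.of)
  actionHom_def _ _ := rfl
  actionHomRight_id x m := by
    ext
    exact LaxModuleMonad.unit_comp x m.of
  id_actionHomLeft x m := by
    rw [MonoidalLeftAction.id_actionHomLeft]
    exact (Kleisli.Adjunction.toKleisli T).map_id _
  actionHom_comp f₁ f₂ g₁ g₂ := by
    rw [kleisliActionHom_comp, MonoidalLeftAction.comp_actionHomLeft, pureHom_comp]
    simp only [Category.assoc]
    rw [← reassoc_of% (kleisliActionHom_exchange T f₂ g₁)]
  actionAssocIso_hom_naturality {c₁ c₂ c₃ c₄ d₁ d₂} f g h := by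
    dsimp only [pureIso_hom]
    have e := congrArg (pureHom T)
      (MonoidalLeftAction.actionAssocIso_hom_naturality f g (𝟙 d₁.of))
    rw [MonoidalLeftAction.actionHom_id, MonoidalLeftAction.actionHom_id,
      MonoidalLeftAction.actionHom_def, pureHom_comp, pureHom_comp, pureHom_comp] at e
    rw [Category.assoc, pureIso_hom, pureIso_hom, kleisliActionHom_tensor,
      kleisliActionHom_comp, kleisliActionHom_map,
      reassoc_of% e]
  actionUnitIso_hom_naturality f := (kleisliActionHom_unit T f).symm
  whiskerLeft_actionHomLeft c _ _ f d := by
    dsimp only [pureIso_hom, pureIso_inv]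
    refine (congrArg _ (MonoidalLeftAction.whiskerLeft_actionHomLeft c f d.of)).trans ?_
    rw [pureHom_comp, pureHom_comp, ← kleisliActionHom_map]
    rfl
  whiskerRight_actionHomLeft c f d := by
    refine (congrArg _ (MonoidalLeftAction.whiskerRight_actionHomLeft c f d.of)).trans ?_
    rw [pureHom_comp, pureHom_comp]
    rfl
  associator_actionHom c₁ c₂ c₃ d := by
    have h := congrArg (pureHom T)
      (MonoidalLeftAction.associator_actionHom c₁ c₂ c₃ d.of)
    rw [pureHom_comp, pureHom_comp, pureHom_comp, ← kleisliActionHom_map] at h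
    exact h
  leftUnitor_actionHom c d := by
    refine (congrArg _ (MonoidalLeftAction.leftUnitor_actionHom c d.of)).trans ?_
    rw [pureHom_comp]
    rfl
  rightUnitor_actionHom c d := by
    refine (congrArg _ (MonoidalLeftAction.rightUnitor_actionHom c d.of)).trans ?_
    rw [pureHom_comp, ← kleisliActionHom_map]
    rfl

end KleisliAction

section Linton

variable {C}

/-- The morphism `T (x ▷ ∇) : T (x ▷ T m) ⟶ T (x ▷ m)` of free `T`-algebras, for a `T`-algebra
`(m, ∇)`. -/
def lintonFst (x : C) (m : T.Algebra) :
    T.free.obj (x ⊙ₗ T.obj m.A) ⟶ T.free.obj (x ⊙ₗ m.A) :=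
  T.free.map (x ⊴ₗ m.a)

/-- For `m : M`, the morphism `μ ∘ T (T_a) : T (x ▷ T m) ⟶ T T (x ▷ m) ⟶ T (x ▷ m)` of free
`T`-algebras. -/
def lintonMul (x : C) (m : M) :
    T.free.obj (x ⊙ₗ T.obj m) ⟶ T.free.obj (x ⊙ₗ m) where
  f := T.map (μₗ T.toFunctor x m) ≫ T.μ.app (x ⊙ₗ m)
  h := free_hom T (μₗ T.toFunctor x m)

/-- The free `T`-algebra morphism `T m ⟶ m` given by the structure map of `m`. -/
def algebraCounit (m : T.Algebra) : T.free.obj m.A ⟶ m where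
  f := m.a
  h := m.assoc.symm

variable (C) in
/-- The data exhibiting a left action of `C` on the Eilenberg–Moore category of `T` as the action
by Linton coequalisers: algebra morphisms `π x m : T (x ▷ m) ⟶ x ▶ m` which are coequalisers in
the category of `T`-algebras of the two morphisms `T (x ▷ T m) ⇉ T (x ▷ m)`, such that `▶` on
morphisms, its associator and its unitor are the ones induced on coequalisers by the
corresponding morphisms of `M`. -/
structure LintonPresentation [MonoidalLeftAction C T.Algebra] where
  π (x : C) (m : T.Algebra) : T.free.obj (x ⊙ₗ m.A) ⟶ x ⊙ₗ m
  condition (x : C) (m : T.Algebra) : lintonFst T x m ≫ π x m = lintonMul T x m.A ≫ π x m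
  isColimit (x : C) (m : T.Algebra) : IsColimit (Cofork.ofπ (π x m) (condition x m))
  actionHomLeft {x y : C} (f : x ⟶ y) (m : T.Algebra) :
    π x m ≫ f ⊵ₗ m = T.free.map (f ⊵ₗ m.A) ≫ π y m
  actionHomRight (x : C) {m n : T.Algebra} (g : m ⟶ n) :
    π x m ≫ x ⊴ₗ g = T.free.map (x ⊴ₗ g.f) ≫ π x n
  associator (x y : C) (m : T.Algebra) :
    π (x ⊗ y) m ≫ (αₗ x y m).hom =
      T.free.map ((αₗ x y m.A).hom ≫ x ⊴ₗ (T.η.app (y ⊙ₗ m.A) ≫ (π y m).f)) ≫ π x (y ⊙ₗ m)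
  unitor (m : T.Algebra) :
    π (𝟙_ C) m ≫ (λₗ m).hom = T.free.map (λₗ m.A).hom ≫ algebraCounit T m

end Linton

/-- A `C`-module structure on the Eilenberg–Moore category of `T` extending that of the Kleisli
category: a left action of `C` on `T.Algebra` together with the structure of a strong `C`-module
functor on the embedding `ι`. -/
structure Extension [LaxModuleMonad C T] where
  [action : MonoidalLeftAction C T.Algebra]
  [strong : (embedding T).LeftLinear C]

namespace Extension

variable {C T} [LaxModuleMonad C T]

/-- The coherence morphism `x ▶ ι m ⟶ ι (x ▷ m)` of the embedding. -/
def coherence (E : Extension C T) (x : C) (m : Kleisli T) :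
    E.action.actionObj x ((embedding T).obj m) ⟶ (embedding T).obj (x ⊙ₗ m) :=
  letI := E.action
  letI := E.strong
  μₗ (embedding T) x m

/-- The action of `C` on `T.Algebra` is right exact in the second variable. -/
def RightExact (E : Extension C T) : Prop :=
  letI := E.action
  ∀ x : C, PreservesFiniteColimits (MonoidalLeftAction.actionLeft T.Algebra x)

/-- `k`-bilinearity of the action of `C` on `T.Algebra`. -/
def Bilinear (E : Extension C T) (k : Type*) [Field k] [Preadditive C] [Linear k C]
    [Preadditive M] [Linear k M] [T.toFunctor.Additive] [T.toFunctor.Linear k] : Prop :=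
  letI := E.action
  BilinearAction k C T.Algebra

/-- The action of `C` on `T.Algebra` is the one by Linton coequalisers, and the module functor
structure of `ι` is the one induced by `T (x ▷ T m) ⟶ T (x ▷ m)`. -/
def IsLinton (E : Extension C T) : Prop :=
  letI := E.action
  ∃ P : LintonPresentation C T, ∀ (x : C) (m : Kleisli T),
    P.π x ((embedding T).obj m) ≫ E.coherence x m = lintonMul T x m.of

/-- The structures of a strong `C`-module functor on the identity functor of `T.Algebra`, from the
first to the second of two `C`-module structures on `T.Algebra`. -/
abbrev IdentityStrong (E₁ E₂ : Extension C T) :=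
  @Functor.LeftLinear T.Algebra T.Algebra _ _ (𝟭 T.Algebra) C _ _ E₁.action E₂.action

/-- The coherence isomorphism `x ▶₂ m ⟶ x ▶₁ m` of a strong `C`-module structure on the
identity functor. -/
def IdentityStrong.hom {E₁ E₂ : Extension C T} (S : IdentityStrong E₁ E₂) (x : C)
    (m : T.Algebra) : E₂.action.actionObj x m ⟶ E₁.action.actionObj x m :=
  @μₗ T.Algebra T.Algebra _ _ (𝟭 T.Algebra) C _ _ E₁.action E₂.action S.toLaxLeftLinear x m

end Extension

end ModuleMonad

/-! An algebra morphism out of the free algebra `T (x ▷ m)` is the same as a morphism out of `x ▷ m`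
in `M`, and it coequalises the Linton pair exactly when that morphism is balanced
(`isBalanced_iff_freeDesc`). Hence `x ▶ m` represents balanced maps, with universal one `bal`.
Structure morphisms of `▶` are obtained by showing that the corresponding composites in `M` are
balanced, and identities between morphisms out of `x ▶ m` are checked after precomposing with `bal`,
where they reduce to axioms of `M` and `T`.

Right exactness enters with the iterated object `x ▶ (y ▶ m)`: since `x ▷ -` and `T` preserve
coequalisers, balanced maps out of `x ▷ (y ▶ m)` can be tested and built on `x ▷ T (y ▷ m)`. This
gives the inverse associator (`exists_lintonAssocInv`). On a free algebra the lax structure `x ▷ T m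
⟶ T (x ▷ m)` is itself a universal balanced map, whence `x ▶ ι m ≅ ι (x ▷ m)`.

For uniqueness, every algebra is, compatibly with morphisms, a coequaliser of objects in the image
of `ι`. On that image the two actions are identified through `ι (x ▷ m)`; right exactness extends
this identification to all algebras, in one way only. The argument (`existsUnique_leftLinear`) works
for any coequaliser-preserving functor `F` in place of the identity. -/

namespace ModuleMonad

open Functor.LaxLeftLinear MonoidalLeftAction

/-! ### Morphisms out of free algebras and their restriction to generators. -/

section FreeAlgebra

variable {M : Type*} [Category* M] {T : Monad M}

/-- The morphism out of a free algebra induced by a morphism out of its generators. -/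
@[simps]
def freeDesc {p : M} {n : T.Algebra} (g : p ⟶ n.A) : T.free.obj p ⟶ n where
  f := T.map g ≫ n.a
  h := by
    have e : T.map (T.map g) ≫ T.μ.app n.A = T.μ.app p ≫ T.map g := T.μ.naturality g
    change T.map (T.map g ≫ n.a) ≫ n.a = T.μ.app p ≫ T.map g ≫ n.a
    rw [← reassoc_of% e, Functor.map_comp, Category.assoc, n.assoc]

lemma unit_map_comp_a {p : M} {n : T.Algebra} (g : p ⟶ n.A) :
    T.η.app p ≫ T.map g ≫ n.a = g := by
  have e : g ≫ T.η.app n.A = T.η.app p ≫ T.map g := T.η.naturality g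
  rw [← reassoc_of% e, n.unit]
  exact Category.comp_id _

lemma map_map_comp_a {p : M} {n : T.Algebra} (g : p ⟶ n.A) :
    T.map (T.map g ≫ n.a) ≫ n.a = T.μ.app p ≫ T.map g ≫ n.a :=
  (freeDesc g).h

/-- The underlying morphism of a morphism out of a free algebra. -/
def freeMap {p : M} {n : T.Algebra} (q : T.free.obj p ⟶ n) : T.obj p ⟶ n.A :=
  q.f

/-- The restriction to generators of a morphism out of a free algebra. -/
def freeRestrict {p : M} {n : T.Algebra} (q : T.free.obj p ⟶ n) : p ⟶ n.A :=
  T.η.app p ≫ freeMap q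

@[simp]
lemma freeMap_freeDesc {p : M} {n : T.Algebra} (g : p ⟶ n.A) :
    freeMap (freeDesc g) = T.map g ≫ n.a :=
  rfl

@[simp]
lemma freeMap_comp {p : M} {n n' : T.Algebra} (q : T.free.obj p ⟶ n) (k : n ⟶ n') :
    freeMap (q ≫ k) = freeMap q ≫ k.f :=
  rfl

@[simp]
lemma freeRestrict_freeDesc {p : M} {n : T.Algebra} (g : p ⟶ n.A) :
    freeRestrict (freeDesc g) = g :=
  unit_map_comp_a g

@[simp]
lemma freeRestrict_comp {p : M} {n n' : T.Algebra} (q : T.free.obj p ⟶ n) (k : n ⟶ n') :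
    freeRestrict (q ≫ k) = freeRestrict q ≫ k.f := by
  rw [freeRestrict, freeMap_comp, freeRestrict, Category.assoc]

@[simp]
lemma freeRestrict_map_comp {p p' : M} {n : T.Algebra} (f : p' ⟶ p) (q : T.free.obj p ⟶ n) :
    freeRestrict (T.free.map f ≫ q) = f ≫ freeRestrict q := by
  have e : f ≫ T.η.app p = T.η.app p' ≫ T.map f := T.η.naturality f
  rw [freeRestrict, freeRestrict, reassoc_of% e]
  rfl

lemma mu_comp_freeMap {p : M} {n : T.Algebra} (q : T.free.obj p ⟶ n) :
    T.μ.app p ≫ freeMap q = T.map (freeMap q) ≫ n.a :=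
  q.h.symm

@[simp]
lemma freeDesc_freeRestrict {p : M} {n : T.Algebra} (q : T.free.obj p ⟶ n) :
    freeDesc (freeRestrict q) = q := by
  ext
  change T.map (T.η.app p ≫ freeMap q) ≫ n.a = freeMap q
  rw [Functor.map_comp, Category.assoc, ← mu_comp_freeMap]
  exact T.right_unit_assoc p _

lemma map_freeRestrict_comp_a {p : M} {n : T.Algebra} (q : T.free.obj p ⟶ n) :
    T.map (freeRestrict q) ≫ n.a = freeMap q :=
  congrArg Monad.Algebra.Hom.f (freeDesc_freeRestrict q)

lemma freeHom_ext {p : M} {n : T.Algebra} {q q' : T.free.obj p ⟶ n}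
    (h : freeRestrict q = freeRestrict q') : q = q' := by
  rw [← freeDesc_freeRestrict q, h, freeDesc_freeRestrict]

@[simp]
lemma freeRestrict_algebraCounit (m : T.Algebra) : freeRestrict (algebraCounit T m) = 𝟙 m.A :=
  m.unit

end FreeAlgebra

/-! ### Balanced maps. -/

section Balanced

variable {C : Type*} [Category* C] [MonoidalCategory C]
  {M : Type*} [Category* M] [MonoidalLeftAction C M]
  {T : Monad M} [T.toFunctor.LaxLeftLinear C]

/-- Morphisms `x ▷ m ⟶ n` between (the carriers of) `T`-algebras which are compatible with the
algebra structures of `m` and `n`. They are represented by the Linton coequaliser. -/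
def IsBalanced (x : C) {m n : T.Algebra} (g : x ⊙ₗ m.A ⟶ n.A) : Prop :=
  x ⊴ₗ m.a ≫ g = μₗ T.toFunctor x m.A ≫ T.map g ≫ n.a

namespace IsBalanced

lemma comp {x : C} {m n n' : T.Algebra} {g : x ⊙ₗ m.A ⟶ n.A} (hg : IsBalanced x g)
    (k : n ⟶ n') : IsBalanced x (g ≫ k.f) := by
  have h := hg
  unfold IsBalanced at h ⊢
  rw [reassoc_of% h, Functor.map_comp, Category.assoc, k.h]

lemma actionHomRight_comp {x : C} {m m' n : T.Algebra} {g : x ⊙ₗ m.A ⟶ n.A}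
    (hg : IsBalanced x g) (k : m' ⟶ m) : IsBalanced x (x ⊴ₗ k.f ≫ g) := by
  have h := hg
  unfold IsBalanced at h ⊢
  rw [← actionHomRight_comp_assoc, ← k.h, MonoidalLeftAction.actionHomRight_comp, Category.assoc,
    h, μₗ_naturality_right_assoc, Functor.map_comp, Category.assoc]

lemma actionHomLeft_comp {x y : C} {m n : T.Algebra} {g : y ⊙ₗ m.A ⟶ n.A}
    (hg : IsBalanced y g) (f : x ⟶ y) : IsBalanced x (f ⊵ₗ m.A ≫ g) := by
  have h := hg
  unfold IsBalanced at h ⊢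
  rw [action_exchange_assoc, h, μₗ_naturality_left_assoc, Functor.map_comp, Category.assoc]

/-- A balanced map is determined on the image of a free algebra by its values on generators. -/
lemma actionHomRight_freeHom_comp {x : C} {p : M} {m n : T.Algebra} {g : x ⊙ₗ m.A ⟶ n.A}
    (hg : IsBalanced x g) (q : T.free.obj p ⟶ m) :
    x ⊴ₗ freeMap q ≫ g =
      μₗ T.toFunctor x p ≫ T.map (x ⊴ₗ freeRestrict q ≫ g) ≫ n.a := by
  unfold IsBalanced at hg
  rw [← map_freeRestrict_comp_a, MonoidalLeftAction.actionHomRight_comp, Category.assoc, hg, μₗ_naturality_right_assoc,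
    Functor.map_comp, Category.assoc]

end IsBalanced

variable (C) in
lemma isBalanced_unit (m : T.Algebra) : IsBalanced (n := m) (𝟙_ C) (λₗ m.A).hom := by
  unfold IsBalanced
  rw [← actionUnitIso_hom_naturality, μₗ_unitality, Category.assoc]

end Balanced

/-! ### The Linton coequaliser as the representing object of balanced maps. -/

section LintonCoequalizer

variable {C : Type*} [Category* C] [MonoidalCategory C]
  {M : Type*} [Category* M] [MonoidalLeftAction C M]
  (T : Monad M) [T.toFunctor.LaxLeftLinear C]

lemma freeRestrict_lintonMul_comp {x : C} {m : M} {n : T.Algebra}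
    (q : T.free.obj (x ⊙ₗ m) ⟶ n) :
    freeRestrict (lintonMul T x m ≫ q) = μₗ T.toFunctor x m ≫ freeMap q := by
  have e : freeRestrict (lintonMul T x m) = μₗ T.toFunctor x m :=
    freeRestrict_freeDesc (n := T.free.obj (x ⊙ₗ m)) (μₗ T.toFunctor x m)
  rw [freeRestrict_comp, e]
  rfl

/-- Both composites start at a free algebra, so they agree as soon as they agree on the generators
`x ▷ T m`; there they are the two sides of the balancedness equation. -/
lemma isBalanced_iff_freeDesc {x : C} {m n : T.Algebra} (g : x ⊙ₗ m.A ⟶ n.A) :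
    IsBalanced x g ↔ lintonFst T x m ≫ freeDesc g = lintonMul T x m.A ≫ freeDesc g := by
  have e₁ : freeRestrict (lintonFst T x m ≫ freeDesc g) = x ⊴ₗ m.a ≫ freeRestrict (freeDesc g) :=
    freeRestrict_map_comp _ _
  have e₂ := freeRestrict_lintonMul_comp T (freeDesc g)
  rw [freeRestrict_freeDesc] at e₁
  rw [freeMap_freeDesc] at e₂
  unfold IsBalanced
  rw [← e₁, ← e₂]
  exact ⟨freeHom_ext, fun h => by rw [h]⟩

variable [HasCoequalizers T.Algebra]

/-- The Linton coequaliser `x ▶ m`. -/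
noncomputable def lintonObj (x : C) (m : T.Algebra) : T.Algebra :=
  coequalizer (lintonFst T x m) (lintonMul T x m.A)

/-- The projection of `T (x ▷ m)` onto the Linton coequaliser. -/
noncomputable def lintonπ (x : C) (m : T.Algebra) : T.free.obj (x ⊙ₗ m.A) ⟶ lintonObj T x m :=
  coequalizer.π _ _

lemma lintonπ_condition (x : C) (m : T.Algebra) :
    lintonFst T x m ≫ lintonπ T x m = lintonMul T x m.A ≫ lintonπ T x m :=
  coequalizer.condition _ _

/-- `lintonπ` is a coequaliser. -/
noncomputable def lintonIsColimit (x : C) (m : T.Algebra) :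
    IsColimit (Cofork.ofπ (lintonπ T x m) (lintonπ_condition T x m)) :=
  coequalizerIsCoequalizer _ _

/-- The universal balanced map `x ▷ m ⟶ x ▶ m`. -/
noncomputable def bal (x : C) (m : T.Algebra) : x ⊙ₗ m.A ⟶ (lintonObj T x m).A :=
  freeRestrict (lintonπ T x m)

lemma freeDesc_bal (x : C) (m : T.Algebra) : freeDesc (bal T x m) = lintonπ T x m :=
  freeDesc_freeRestrict _

lemma isBalanced_bal (x : C) (m : T.Algebra) : IsBalanced x (bal T x m) := by
  rw [isBalanced_iff_freeDesc, freeDesc_bal, lintonπ_condition]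

variable {T}

/-- The universal property of `x ▶ m`. -/
noncomputable def lintonDesc {x : C} {m n : T.Algebra} (g : x ⊙ₗ m.A ⟶ n.A)
    (hg : IsBalanced x g) : lintonObj T x m ⟶ n :=
  coequalizer.desc (freeDesc g) ((isBalanced_iff_freeDesc T g).1 hg)

@[simp]
lemma bal_lintonDesc {x : C} {m n : T.Algebra} (g : x ⊙ₗ m.A ⟶ n.A) (hg : IsBalanced x g) :
    bal T x m ≫ (lintonDesc g hg).f = g := by
  have h : lintonπ T x m ≫ lintonDesc g hg = freeDesc g := coequalizer.π_desc _ _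
  have h' := congrArg freeRestrict h
  rwa [freeRestrict_comp, freeRestrict_freeDesc] at h'

@[simp]
lemma bal_lintonDesc_assoc {x : C} {m n : T.Algebra} (g : x ⊙ₗ m.A ⟶ n.A) (hg : IsBalanced x g)
    {Z : M} (h : n.A ⟶ Z) : bal T x m ≫ (lintonDesc g hg).f ≫ h = g ≫ h := by
  rw [← Category.assoc, bal_lintonDesc]

lemma linton_hom_ext {x : C} {m n : T.Algebra} {k k' : lintonObj T x m ⟶ n}
    (h : bal T x m ≫ k.f = bal T x m ≫ k'.f) : k = k' := by
  refine coequalizer.hom_ext (freeHom_ext ?_)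
  exact (freeRestrict_comp _ _).trans (h.trans (freeRestrict_comp _ _).symm)

end LintonCoequalizer

/-! ### The module structure on algebras by Linton coequalisers. -/

section LintonAction

variable {C : Type*} [Category* C] [MonoidalCategory C]
  {M : Type*} [Category* M] [MonoidalLeftAction C M]
  (T : Monad M) [T.toFunctor.LaxLeftLinear C]
  [HasCoequalizers T.Algebra]

/-- The action of a morphism of `C` on Linton coequalisers. -/
noncomputable def lintonHomLeft {x y : C} (f : x ⟶ y) (m : T.Algebra) :
    lintonObj T x m ⟶ lintonObj T y m :=
  lintonDesc (f ⊵ₗ m.A ≫ bal T y m) ((isBalanced_bal T y m).actionHomLeft_comp f)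

/-- The action of an object of `C` on a morphism of algebras. -/
noncomputable def lintonHomRight (x : C) {m n : T.Algebra} (g : m ⟶ n) :
    lintonObj T x m ⟶ lintonObj T x n :=
  lintonDesc (x ⊴ₗ g.f ≫ bal T x n) ((isBalanced_bal T x n).actionHomRight_comp g)

@[simp]
lemma bal_lintonHomLeft {x y : C} (f : x ⟶ y) (m : T.Algebra) :
    bal T x m ≫ (lintonHomLeft T f m).f = f ⊵ₗ m.A ≫ bal T y m :=
  bal_lintonDesc _ _

@[simp]
lemma bal_lintonHomRight (x : C) {m n : T.Algebra} (g : m ⟶ n) :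
    bal T x m ≫ (lintonHomRight T x g).f = x ⊴ₗ g.f ≫ bal T x n :=
  bal_lintonDesc _ _

@[simp]
lemma bal_lintonHomLeft_assoc {x y : C} (f : x ⟶ y) (m : T.Algebra) {Z : M}
    (h : (lintonObj T y m).A ⟶ Z) :
    bal T x m ≫ (lintonHomLeft T f m).f ≫ h = f ⊵ₗ m.A ≫ bal T y m ≫ h := by
  rw [reassoc_of% bal_lintonHomLeft]

@[simp]
lemma bal_lintonHomRight_assoc (x : C) {m n : T.Algebra} (g : m ⟶ n) {Z : M}
    (h : (lintonObj T x n).A ⟶ Z) :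
    bal T x m ≫ (lintonHomRight T x g).f ≫ h = x ⊴ₗ g.f ≫ bal T x n ≫ h := by
  rw [reassoc_of% bal_lintonHomRight]

/-- The unitor of the action by Linton coequalisers. -/
noncomputable def lintonUnitIso (m : T.Algebra) : lintonObj T (𝟙_ C) m ≅ m where
  hom := lintonDesc (λₗ m.A).hom (isBalanced_unit C m)
  inv :=
    { f := (λₗ m.A).inv ≫ bal T (𝟙_ C) m
      h := by
        have h := isBalanced_bal T (𝟙_ C) m
        unfold IsBalanced at h
        rw [Functor.map_comp, Category.assoc, ← μₗ_unitality_inv_assoc, ← h,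
          actionUnitIso_inv_naturality_assoc] }
  hom_inv_id := by
    apply linton_hom_ext
    rw [Monad.Algebra.comp_f, bal_lintonDesc_assoc, Iso.hom_inv_id_assoc]
    exact (Category.comp_id _).symm
  inv_hom_id := by
    ext
    rw [Monad.Algebra.comp_f, Category.assoc, bal_lintonDesc, Iso.inv_hom_id]
    rfl

@[simp]
lemma bal_lintonUnitIso_hom (m : T.Algebra) :
    bal T (𝟙_ C) m ≫ (lintonUnitIso T m).hom.f = (λₗ m.A).hom :=
  bal_lintonDesc (n := m) _ (isBalanced_unit C m)

/-- Balancedness of the inner `bal` moves the algebra structure of `m` to that of `y ▶ m`,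
balancedness of the outer one moves it on to `x ▶ (y ▶ m)`, and associativity of the lax structure
of `T` combines the two moves. -/
lemma isBalanced_assoc (x y : C) (m : T.Algebra) :
    IsBalanced (x ⊗ y)
      ((αₗ x y m.A).hom ≫ x ⊴ₗ bal T y m ≫ bal T x (lintonObj T y m)) := by
  have hy := isBalanced_bal T y m
  have hx := isBalanced_bal T x (lintonObj T y m)
  unfold IsBalanced at hx hy ⊢
  rw [tensor_actionHomRight, Category.assoc, Category.assoc, Iso.inv_hom_id_assoc,
    ← actionHomRight_comp_assoc, hy]
  simp only [actionHomRight_comp, Category.assoc, Functor.map_comp]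
  rw [hx, μₗ_associativity_assoc, μₗ_naturality_right_assoc]

/-- The associator of the action by Linton coequalisers. -/
noncomputable def lintonAssocHom (x y : C) (m : T.Algebra) :
    lintonObj T (x ⊗ y) m ⟶ lintonObj T x (lintonObj T y m) :=
  lintonDesc _ (isBalanced_assoc T x y m)

@[simp]
lemma bal_lintonAssocHom (x y : C) (m : T.Algebra) :
    bal T (x ⊗ y) m ≫ (lintonAssocHom T x y m).f =
      (αₗ x y m.A).hom ≫ x ⊴ₗ bal T y m ≫ bal T x (lintonObj T y m) :=
  bal_lintonDesc _ _

@[simp]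
lemma bal_lintonAssocHom_assoc (x y : C) (m : T.Algebra) {Z : M}
    (h : (lintonObj T x (lintonObj T y m)).A ⟶ Z) :
    bal T (x ⊗ y) m ≫ (lintonAssocHom T x y m).f ≫ h =
      (αₗ x y m.A).hom ≫ x ⊴ₗ bal T y m ≫ bal T x (lintonObj T y m) ≫ h := by
  rw [reassoc_of% bal_lintonAssocHom]

lemma actionHomRight_bal_comp_assoc {x y : C} {m n : T.Algebra} {k : lintonObj T y m ⟶ n}
    {g : y ⊙ₗ m.A ⟶ n.A} (h : bal T y m ≫ k.f = g) {Z : M} (l : x ⊙ₗ n.A ⟶ Z) :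
    x ⊴ₗ bal T y m ≫ x ⊴ₗ k.f ≫ l = x ⊴ₗ g ≫ l := by
  rw [← actionHomRight_comp_assoc, h]

section RightExact

variable [PreservesColimitsOfShape WalkingParallelPair T.forget]
  [∀ x : C, PreservesColimitsOfShape WalkingParallelPair (actionLeft M x)]

/-- `x ▷ -` maps Linton coequalisers to coequalisers. -/
lemma exists_actionHomRight_lintonπ_fac (x y : C) (m : T.Algebra) {Z : M}
    (g : x ⊙ₗ T.obj (y ⊙ₗ m.A) ⟶ Z)
    (hg : x ⊴ₗ T.map (y ⊴ₗ m.a) ≫ g =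
      x ⊴ₗ T.map (μₗ T.toFunctor y m.A) ≫ x ⊴ₗ T.μ.app (y ⊙ₗ m.A) ≫ g) :
    ∃ l : x ⊙ₗ (lintonObj T y m).A ⟶ Z, x ⊴ₗ freeMap (lintonπ T y m) ≫ l = g := by
  let h := isColimitCoforkMapOfIsColimit (T.forget ⋙ actionLeft M x) _ (lintonIsColimit T y m)
  refine ⟨Cofork.IsColimit.desc h g ?_, Cofork.IsColimit.π_desc' h g _⟩
  refine hg.trans ?_
  rw [← actionHomRight_comp_assoc]
  rfl

instance epi_actionHomRight_lintonπ (x y : C) (m : T.Algebra) :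
    Epi (x ⊴ₗ freeMap (lintonπ T y m)) :=
  epi_of_isColimit_cofork
    (isColimitCoforkMapOfIsColimit (T.forget ⋙ actionLeft M x) _ (lintonIsColimit T y m))

/-- The map `x ▷ bal` need not be epi, but `x ▷ π` is, for the coequaliser `π : T (y ▷ m) ⟶ y ▶ m`.
A balanced map restricted along `x ▷ π` is recovered from its values on the generators `x ▷ (y ▷
m)`. -/
lemma linton_hom_ext₂ {x y : C} {m n : T.Algebra} {k k' : lintonObj T x (lintonObj T y m) ⟶ n}
    (h : x ⊴ₗ bal T y m ≫ bal T x (lintonObj T y m) ≫ k.f =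
      x ⊴ₗ bal T y m ≫ bal T x (lintonObj T y m) ≫ k'.f) : k = k' := by
  apply linton_hom_ext
  rw [← cancel_epi (x ⊴ₗ freeMap (lintonπ T y m)),
    ((isBalanced_bal T x _).comp k).actionHomRight_freeHom_comp,
    ((isBalanced_bal T x _).comp k').actionHomRight_freeHom_comp]
  exact congrArg (fun g => _ ≫ T.map g ≫ _) h

variable [PreservesColimitsOfShape WalkingParallelPair T.toFunctor]

instance epi_actionHomRight_map_lintonπ (x y : C) (m : T.Algebra) :
    Epi (x ⊴ₗ T.map (freeMap (lintonπ T y m))) :=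
  epi_of_isColimit_cofork
    (isColimitCoforkMapOfIsColimit (T.forget ⋙ T.toFunctor ⋙ actionLeft M x) _
      (lintonIsColimit T y m))

variable [LaxModuleMonad C T]

/-- The inverse associator must be defined on `x ▷ (y ▶ m)`, which is a quotient of `x ▷ T (y ▷ m)`
because `x ▷ -` is right exact. -/
lemma exists_lintonAssocInv (x y : C) (m : T.Algebra) :
    ∃ k : lintonObj T x (lintonObj T y m) ⟶ lintonObj T (x ⊗ y) m,
      x ⊴ₗ bal T y m ≫ bal T x (lintonObj T y m) ≫ k.f =
        (αₗ x y m.A).inv ≫ bal T (x ⊗ y) m := by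
  set n := lintonObj T (x ⊗ y) m
  set h : x ⊙ₗ y ⊙ₗ m.A ⟶ n.A := (αₗ x y m.A).inv ≫ bal T (x ⊗ y) m with h_def
  -- Balancedness over `x ⊗ y`, transported along the associator of `M`.
  have hb : x ⊴ₗ y ⊴ₗ m.a ≫ h =
      x ⊴ₗ μₗ T.toFunctor y m.A ≫ μₗ T.toFunctor x (y ⊙ₗ m.A) ≫ T.map h ≫ n.a := by
    have hb := isBalanced_bal T (x ⊗ y) m
    unfold IsBalanced at hb
    rw [tensor_actionHomRight, Category.assoc, Category.assoc, ← Iso.eq_inv_comp] at hb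
    rw [hb, h_def, Functor.map_comp, Category.assoc, μₗ_associativity_inv_assoc]
  -- The map on `x ▷ T (y ▷ m)` is forced: it is the only possible value of a balanced map that
  -- equals `h` on generators (`IsBalanced.actionHomRight_freeHom_comp`).
  obtain ⟨l, hl⟩ := exists_actionHomRight_lintonπ_fac T x y m
    (μₗ T.toFunctor x (y ⊙ₗ m.A) ≫ T.map h ≫ n.a) (by
      rw [μₗ_naturality_right_assoc, ← Functor.map_comp_assoc, hb]
      simp only [Functor.map_comp, Category.assoc]
      have e : T.map (T.map h) ≫ T.μ.app n.A = T.μ.app _ ≫ T.map h := T.μ.naturality h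
      rw [← μₗ_naturality_right_assoc, ← n.assoc, reassoc_of% e, ← reassoc_of% LaxModuleMonad.mul_comp])
  have hl' : IsBalanced x l := by
    unfold IsBalanced
    -- Balancedness of `l` is an equation on `x ▷ T (y ▶ m)`; it is tested on `x ▷ T T (y ▷ m)`,
    -- which maps onto it epimorphically because `T` preserves coequalisers too.
    rw [← cancel_epi (x ⊴ₗ T.map (freeMap (lintonπ T y m))), ← actionHomRight_comp_assoc,
      ← mu_comp_freeMap, actionHomRight_comp_assoc, hl, reassoc_of% LaxModuleMonad.mul_comp,
      μₗ_naturality_right_assoc, ← Functor.map_comp_assoc, hl, ← map_map_comp_a,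
      ← Functor.map_comp_assoc]
  refine ⟨lintonDesc l hl', ?_⟩
  rw [bal_lintonDesc, bal, freeRestrict, actionHomRight_comp, Category.assoc, hl,
    reassoc_of% LaxModuleMonad.unit_comp]
  exact unit_map_comp_a h

/-- The associator of the action by Linton coequalisers. -/
@[simps hom]
noncomputable def lintonAssocIso (x y : C) (m : T.Algebra) :
    lintonObj T (x ⊗ y) m ≅ lintonObj T x (lintonObj T y m) where
  hom := lintonAssocHom T x y m
  inv := (exists_lintonAssocInv T x y m).choose
  hom_inv_id := by
    apply linton_hom_ext
    rw [Monad.Algebra.comp_f, bal_lintonAssocHom_assoc,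
      (exists_lintonAssocInv T x y m).choose_spec, Iso.hom_inv_id_assoc]
    exact (Category.comp_id _).symm
  inv_hom_id := by
    apply linton_hom_ext₂
    have h := (exists_lintonAssocInv T x y m).choose_spec
    rw [Monad.Algebra.comp_f, reassoc_of% h, bal_lintonAssocHom, Iso.inv_hom_id_assoc]
    exact (congrArg (_ ≫ ·) (Category.comp_id _)).symm

/-- The action of `C` on the Eilenberg–Moore category by Linton coequalisers. -/
@[reducible]
noncomputable def lintonAction : MonoidalLeftAction C T.Algebra where
  actionObj := lintonObj T
  actionHomLeft := lintonHomLeft T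
  actionHomRight := lintonHomRight T
  actionAssocIso := lintonAssocIso T
  actionUnitIso := lintonUnitIso T
  actionHomRight_id x m := by
    apply linton_hom_ext
    simp
  id_actionHomLeft x m := by
    apply linton_hom_ext
    simp
  actionHom_comp f₁ f₂ g₁ g₂ := by
    apply linton_hom_ext
    simp [action_exchange_assoc]
  actionAssocIso_hom_naturality {_ _ _ c₄ d₁ d₂} f g h := by
    apply linton_hom_ext
    -- Naturality in the two variables from `C` only; the third variable is handled by the rule for
    -- `lintonHomRight`.
    have e := actionAssocIso_hom_naturality f g (𝟙 d₁.A)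
    rw [actionHom_id, actionHom_id, actionHom_def] at e
    simp [actionHomRight_bal_comp_assoc T (bal_lintonHomLeft T g d₁),
      actionHomRight_bal_comp_assoc T (bal_lintonHomRight T c₄ h), action_exchange_assoc,
      reassoc_of% e, -actionHomLeft_action]
  actionUnitIso_hom_naturality f := by
    apply linton_hom_ext
    simp [reassoc_of% bal_lintonUnitIso_hom T]
  whiskerLeft_actionHomLeft c c' c'' f d := by
    -- The inverse associator is known only through an existence statement, so it is moved across to
    -- leave only the forward one, whose composite with `bal` is explicit.
    rw [← Category.assoc, Iso.eq_comp_inv]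
    apply linton_hom_ext
    simp [actionHomRight_bal_comp_assoc T (bal_lintonHomLeft T f d)]
  whiskerRight_actionHomLeft c f d := by
    rw [← Category.assoc, Iso.eq_comp_inv]
    apply linton_hom_ext
    simp [action_exchange_assoc]
  associator_actionHom c₁ c₂ c₃ d := by
    apply linton_hom_ext
    simp [actionHomRight_bal_comp_assoc T (bal_lintonAssocHom T c₂ c₃ d)]
  leftUnitor_actionHom c d := by
    apply linton_hom_ext
    simp
  rightUnitor_actionHom c d := by
    apply linton_hom_ext
    simp [actionHomRight_bal_comp_assoc T (bal_lintonUnitIso_hom T d)]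

end RightExact

end LintonAction

section LeftLinear

variable {C : Type*} [Category* C] [MonoidalCategory C]
  {D D' : Type*} [Category* D] [Category* D'] [MonoidalLeftAction C D] [MonoidalLeftAction C D']

/-- A lax module functor whose structure morphisms are invertible is a strong module functor. -/
@[reducible]
noncomputable def leftLinearOfIsIso (F : D ⥤ D') [F.LaxLeftLinear C]
    [∀ (c : C) (d : D), IsIso (μₗ F c d)] : F.LeftLinear C where
  δₗ c d := inv (μₗ F c d)
  δₗ_naturality_left f d := by
    rw [IsIso.comp_inv_eq, Category.assoc, IsIso.eq_inv_comp, μₗ_naturality_left]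
  δₗ_naturality_right c _ _ f := by
    rw [IsIso.comp_inv_eq, Category.assoc, IsIso.eq_inv_comp, μₗ_naturality_right]
  δₗ_associativity c c' d := by
    rw [IsIso.inv_comp_eq, μₗ_associativity_assoc]
    simp
  δₗ_unitality_inv d := by
    rw [IsIso.eq_comp_inv, μₗ_unitality_inv]
  μₗ_comp_δₗ c d := IsIso.hom_inv_id _
  δₗ_comp_μₗ c d := IsIso.inv_hom_id _

end LeftLinear

/-! ### The action on free algebras and the strong module structure on the embedding. -/

section LintonExtension

variable {C : Type*} [Category* C] [MonoidalCategory C]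
  {M : Type*} [Category* M] [MonoidalLeftAction C M]
  (T : Monad M) [T.toFunctor.LaxLeftLinear C] [LaxModuleMonad C T]

/-- This is the condition that the multiplication of `T` is a module transformation, read as
balancedness. -/
lemma isBalanced_μₗ (x : C) (m : M) :
    IsBalanced (m := T.free.obj m) (n := T.free.obj (x ⊙ₗ m)) x (μₗ T.toFunctor x m) :=
  LaxModuleMonad.mul_comp x m

variable [HasCoequalizers T.Algebra]

/-- The isomorphism `x ▶ ι m ≅ ι (x ▷ m)`. -/
noncomputable def lintonFreeIso (x : C) (m : M) :
    lintonObj T x (T.free.obj m) ≅ T.free.obj (x ⊙ₗ m) where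
  hom := lintonDesc (n := T.free.obj (x ⊙ₗ m)) (μₗ T.toFunctor x m) (isBalanced_μₗ T x m)
  inv := freeDesc (x ⊴ₗ T.η.app m ≫ bal T x (T.free.obj m))
  hom_inv_id := by
    apply linton_hom_ext
    refine (bal_lintonDesc_assoc (n := T.free.obj (x ⊙ₗ m)) _ (isBalanced_μₗ T x m) _).trans ?_
    -- Applied to the identity of `T m`, whose restriction to generators is the unit, this recovers
    -- `bal` from its restriction along `x ▷ η`.
    have h := (isBalanced_bal T x (T.free.obj m)).actionHomRight_freeHom_comp (𝟙 (T.free.obj m))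
    have h₁ : freeMap (𝟙 (T.free.obj m)) = 𝟙 (T.obj m) := rfl
    have h₂ : freeRestrict (𝟙 (T.free.obj m)) = T.η.app m := Category.comp_id _
    rw [h₁, h₂] at h
    refine h.symm.trans ?_
    refine (congrArg (· ≫ bal T x (T.free.obj m)) (actionHomRight_id x (T.obj m))).trans ?_
    exact (Category.id_comp _).trans (Category.comp_id _).symm
  inv_hom_id := by
    apply freeHom_ext
    rw [freeRestrict_comp, freeRestrict_freeDesc]
    refine (Category.assoc _ _ _).trans ?_
    refine (congrArg (x ⊴ₗ T.η.app m ≫ ·) (bal_lintonDesc (n := T.free.obj (x ⊙ₗ m)) _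
      (isBalanced_μₗ T x m))).trans ?_
    exact (LaxModuleMonad.unit_comp x m).trans (Category.comp_id _).symm

@[simp]
lemma bal_lintonFreeIso_hom (x : C) (m : M) :
    bal T x (T.free.obj m) ≫ (lintonFreeIso T x m).hom.f = μₗ T.toFunctor x m :=
  bal_lintonDesc (n := T.free.obj (x ⊙ₗ m)) _ (isBalanced_μₗ T x m)

lemma bal_lintonFreeIso_hom_assoc (x : C) (m : M) {Z : M} (h : (T.free.obj (x ⊙ₗ m)).A ⟶ Z) :
    bal T x (T.free.obj m) ≫ (lintonFreeIso T x m).hom.f ≫ h = μₗ T.toFunctor x m ≫ h :=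
  (Category.assoc _ _ _).symm.trans (congrArg (· ≫ h) (bal_lintonFreeIso_hom T x m))

section RightExact

variable [PreservesColimitsOfShape WalkingParallelPair T.forget]
  [∀ x : C, PreservesColimitsOfShape WalkingParallelPair (actionLeft M x)]
  [PreservesColimitsOfShape WalkingParallelPair T.toFunctor]

attribute [local instance] lintonAction

/-- The embedding of the Kleisli category as a lax module functor, for the action by Linton
coequalisers. -/
@[reducible]
noncomputable def embeddingLax : (embedding T).LaxLeftLinear C where
  μₗ x m := (lintonFreeIso T x m.of).hom
  μₗ_naturality_left {x y} f m := by
    apply linton_hom_ext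
    refine (bal_lintonHomLeft_assoc T f _ _).trans ?_
    refine Eq.trans ?_ (bal_lintonFreeIso_hom_assoc T x m.of _).symm
    refine (congrArg (_ ≫ ·) (bal_lintonFreeIso_hom T y m.of)).trans ?_
    refine (μₗ_naturality_left T.toFunctor f m.of).trans ?_
    -- A morphism of `M` enters the Kleisli category composed with the unit, which the right unit
    -- law then removes.
    change _ = _ ≫ T.map (f ⊵ₗ m.of ≫ T.η.app _) ≫ T.μ.app _
    rw [Functor.map_comp, Category.assoc, T.right_unit]
    exact (congrArg (μₗ T.toFunctor x m.of ≫ ·) (Category.comp_id _)).symm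
  μₗ_naturality_right x {m n} f := by
    apply linton_hom_ext
    refine (bal_lintonHomRight_assoc T x _ _).trans ?_
    refine Eq.trans ?_ (bal_lintonFreeIso_hom_assoc T x m.of _).symm
    refine (congrArg (_ ≫ ·) (bal_lintonFreeIso_hom T x n.of)).trans ?_
    change x ⊴ₗ (T.map f.of ≫ T.μ.app n.of) ≫ μₗ T.toFunctor x n.of =
      μₗ T.toFunctor x m.of ≫ T.map (x ⊴ₗ f.of ≫ μₗ T.toFunctor x n.of) ≫ T.μ.app _
    rw [actionHomRight_comp, Category.assoc, LaxModuleMonad.mul_comp,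
      μₗ_naturality_right_assoc, Functor.map_comp, Category.assoc]
  μₗ_associativity x y m := by
    apply linton_hom_ext
    refine (bal_lintonFreeIso_hom_assoc T (x ⊗ y) m.of _).trans ?_
    refine Eq.trans ?_ (bal_lintonAssocHom_assoc T x y (T.free.obj m.of) _).symm
    have h₁ := actionHomRight_bal_comp_assoc (x := x) T
      (bal_lintonFreeIso_hom T y m.of) (bal T x (T.free.obj (y ⊙ₗ m.of)) ≫
        (lintonFreeIso T x (y ⊙ₗ m.of)).hom.f)
    have h₁' := h₁.trans (congrArg (_ ≫ ·) (bal_lintonFreeIso_hom T x (y ⊙ₗ m.of)))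
    have h₂ := bal_lintonHomRight_assoc T x (lintonFreeIso T y m.of).hom
        (lintonFreeIso T x (y ⊙ₗ m.of)).hom.f
    refine Eq.trans ?_ (congrArg (fun g => _ ≫ x ⊴ₗ _ ≫ g) h₂).symm
    refine Eq.trans ?_ (congrArg ((αₗ x y (T.obj m.of)).hom ≫ ·) h₁').symm
    refine Eq.trans ?_ (μₗ_associativity T.toFunctor x y m.of)
    change μₗ T.toFunctor (x ⊗ y) m.of ≫ T.map ((αₗ x y m.of).hom ≫ T.η.app _) ≫ T.μ.app _ = _
    rw [Functor.map_comp, Category.assoc, T.right_unit]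
    exact congrArg (μₗ T.toFunctor (x ⊗ y) m.of ≫ ·) (Category.comp_id _)
  μₗ_unitality m := by
    apply linton_hom_ext
    refine (bal_lintonUnitIso_hom T (T.free.obj m.of)).trans ?_
    refine Eq.trans ?_ (bal_lintonFreeIso_hom_assoc T (𝟙_ C) m.of _).symm
    refine (μₗ_unitality T.toFunctor m.of).trans ?_
    change _ = μₗ T.toFunctor (𝟙_ C) m.of ≫ T.map ((λₗ m.of).hom ≫ T.η.app _) ≫ T.μ.app _
    rw [Functor.map_comp, Category.assoc, T.right_unit]
    exact (congrArg (μₗ T.toFunctor (𝟙_ C) m.of ≫ ·) (Category.comp_id _)).symm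

attribute [local instance] embeddingLax

instance isIso_embeddingLax_μₗ (x : C) (m : Kleisli T) : IsIso (μₗ (embedding T) x m) :=
  (lintonFreeIso T x m.of).isIso_hom

variable (C) in
/-- The action by Linton coequalisers as an extension of the action on the Kleisli category. -/
noncomputable def lintonExtension : Extension C T where
  action := lintonAction T
  strong := leftLinearOfIsIso (embedding T)

lemma isLinton_lintonExtension : (lintonExtension C T).IsLinton := by
  refine ⟨{ π := lintonπ T
            condition := lintonπ_condition T
            isColimit := lintonIsColimit T
            actionHomLeft := fun f m => ?_
            actionHomRight := fun x _ _ g => ?_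
            associator := fun x y m => ?_
            unitor := fun m => ?_ }, fun x m => ?_⟩
  · apply freeHom_ext
    exact (freeRestrict_comp _ _).trans
      ((bal_lintonHomLeft T f m).trans (freeRestrict_map_comp _ _).symm)
  · apply freeHom_ext
    exact (freeRestrict_comp _ _).trans
      ((bal_lintonHomRight T x g).trans (freeRestrict_map_comp _ _).symm)
  · apply freeHom_ext
    refine (freeRestrict_comp _ _).trans
      ((bal_lintonAssocHom T x y m).trans (Eq.trans ?_ (freeRestrict_map_comp _ _).symm))
    exact (Category.assoc _ _ _).symm
  · apply freeHom_ext
    refine (freeRestrict_comp _ _).trans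
      ((bal_lintonUnitIso_hom T m).trans (Eq.trans ?_ (freeRestrict_map_comp _ _).symm))
    rw [freeRestrict_algebraCounit, Category.comp_id]
  · apply freeHom_ext
    refine (freeRestrict_comp _ _).trans ((bal_lintonFreeIso_hom T x m.of).trans ?_)
    exact (freeRestrict_freeDesc (n := T.free.obj (x ⊙ₗ m.of)) (μₗ T.toFunctor x m.of)).symm

lemma bilinear_lintonExtension (k : Type*) [Field k] [Preadditive C] [Linear k C]
    [Preadditive M] [Linear k M] [BilinearAction k C M]
    [T.toFunctor.Additive] [T.toFunctor.Linear k] :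
    (lintonExtension C T).Bilinear k where
  actionHomLeft_add f g m := by
    apply linton_hom_ext
    have e := BilinearAction.actionHomLeft_add k f g m.A
    refine (bal_lintonHomLeft T (f + g) m).trans ?_
    refine Eq.trans ?_ (Preadditive.comp_add _ _ _ _ _ _).symm
    refine Eq.trans ?_ (congrArg₂ (· + ·) (bal_lintonHomLeft T f m) (bal_lintonHomLeft T g m)).symm
    rw [e, Preadditive.add_comp]
  actionHomLeft_smul r f m := by
    apply linton_hom_ext
    refine (bal_lintonHomLeft T (r • f) m).trans ?_
    refine Eq.trans ?_ (Linear.comp_smul _ _ _ _ r _).symm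
    refine Eq.trans ?_ (congrArg (r • ·) (bal_lintonHomLeft T f m)).symm
    rw [BilinearAction.actionHomLeft_smul, Linear.smul_comp]
  actionHomRight_add x _ _ f g := by
    apply linton_hom_ext
    have e := BilinearAction.actionHomRight_add k x f.f g.f
    refine (bal_lintonHomRight T x (f + g)).trans ?_
    refine Eq.trans ?_ (Preadditive.comp_add _ _ _ _ _ _).symm
    refine Eq.trans ?_ (congrArg₂ (· + ·) (bal_lintonHomRight T x f) (bal_lintonHomRight T x g)).symm
    rw [← Preadditive.add_comp, ← e]
    rfl
  actionHomRight_smul x _ _ r f := by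
    apply linton_hom_ext
    refine (bal_lintonHomRight T x (r • f)).trans ?_
    refine Eq.trans ?_ (Linear.comp_smul _ _ _ _ r _).symm
    refine Eq.trans ?_ (congrArg (r • ·) (bal_lintonHomRight T x f)).symm
    rw [← Linear.smul_comp, ← BilinearAction.actionHomRight_smul]
    rfl

/-- The action by Linton coequalisers preserves all colimits preserved by `T`, by the forgetful
functor and by the action on `M`. -/
lemma preservesColimitsOfShape_actionLeft (x : C) (J : Type*) [Category* J]
    [PreservesColimitsOfShape J T.forget] [PreservesColimitsOfShape J T.toFunctor]
    [PreservesColimitsOfShape J (actionLeft M x)] :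
    PreservesColimitsOfShape J (actionLeft T.Algebra x) where
  preservesColimit {K} := ⟨fun {c} hc => by
    -- The colimit of the `x ▷ K j` serves to construct the descended map, and that of the `x ▷ T (K
    -- j)` to check that it is balanced.
    have h₁ := isColimitOfPreserves (T.forget ⋙ actionLeft M x) hc
    have h₂ := isColimitOfPreserves (T.forget ⋙ T.toFunctor ⋙ actionLeft M x) hc
    let cocone (s : Cocone (K ⋙ actionLeft T.Algebra x)) :
        Cocone (K ⋙ T.forget ⋙ actionLeft M x) :=
      { pt := s.pt.A
        ι :=
          { app j := bal T x (K.obj j) ≫ (s.ι.app j).f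
            naturality i j f := by
              have h := congrArg Monad.Algebra.Hom.f (s.w f)
              refine (bal_lintonHomRight_assoc T x (K.map f) _).symm.trans ?_
              refine (congrArg (_ ≫ ·) h).trans (Category.comp_id _).symm } }
    obtain ⟨d, fac⟩ : ∃ d : ∀ s : Cocone (K ⋙ actionLeft T.Algebra x), x ⊙ₗ c.pt.A ⟶ s.pt.A,
        ∀ s j, x ⊴ₗ (c.ι.app j).f ≫ d s = bal T x (K.obj j) ≫ (s.ι.app j).f :=
      ⟨fun s => h₁.desc (cocone s), fun s j => h₁.fac (cocone s) j⟩
    refine ⟨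
      { desc s := lintonDesc (m := c.pt) (n := s.pt) (d s) ?_
        fac s j := ?_
        uniq s m hm := ?_ }⟩
    · refine h₂.hom_ext fun j => ?_
      change x ⊴ₗ T.map (c.ι.app j).f ≫ x ⊴ₗ c.pt.a ≫ d s =
        x ⊴ₗ T.map (c.ι.app j).f ≫ μₗ T.toFunctor x c.pt.A ≫ T.map (d s) ≫ s.pt.a
      have hb := (isBalanced_bal T x (K.obj j)).comp (s.ι.app j)
      unfold IsBalanced at hb
      have hc' : T.map (c.ι.app j).f ≫ c.pt.a = (K.obj j).a ≫ (c.ι.app j).f := (c.ι.app j).h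
      have e : x ⊴ₗ T.map (c.ι.app j).f ≫ μₗ T.toFunctor x c.pt.A ≫ T.map (d s) ≫ s.pt.a =
          μₗ T.toFunctor x (K.obj j).A ≫ T.map (x ⊴ₗ (c.ι.app j).f ≫ d s) ≫ s.pt.a := by
        rw [Functor.map_comp, Category.assoc]
        exact μₗ_naturality_right_assoc T.toFunctor x (c.ι.app j).f _
      rw [fac] at e
      rw [← actionHomRight_comp_assoc, hc', actionHomRight_comp_assoc, fac]
      exact hb.trans e.symm
    · apply linton_hom_ext
      refine (bal_lintonHomRight_assoc T x _ _).trans ?_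
      refine (congrArg (_ ≫ ·) (bal_lintonDesc _ _)).trans (fac s j)
    · apply linton_hom_ext
      refine Eq.trans ?_ (bal_lintonDesc _ _).symm
      refine h₁.hom_ext fun j => ?_
      refine Eq.trans ?_ (fac s j).symm
      refine (bal_lintonHomRight_assoc T x (c.ι.app j) _).symm.trans ?_
      exact congrArg (_ ≫ ·) (congrArg Monad.Algebra.Hom.f (hm j))⟩

end RightExact

end LintonExtension

/-! ### Extending a module structure from generators along coequaliser presentations. -/

open Functor.OplaxLeftLinear Functor.LeftLinear

/-- A presentation of an object of the target of `ι` as a coequaliser of objects in the image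
of `ι`. -/
structure CoequalizerPresentation {K A : Type*} [Category* K] [Category* A] (ι : K ⥤ A)
    (a : A) where
  {rel gen : K}
  (fst snd : rel ⟶ gen)
  π : ι.obj gen ⟶ a
  condition : ι.map fst ≫ π = ι.map snd ≫ π
  isColimit : IsColimit (Cofork.ofπ π condition)

namespace CoequalizerPresentation

variable {K A B : Type*} [Category* K] [Category* A] [Category* B] {ι : K ⥤ A} {a : A}
  (P : CoequalizerPresentation ι a) (G : A ⥤ B)
  [PreservesColimitsOfShape WalkingParallelPair G]

lemma epi_map_π : Epi (G.map P.π) :=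
  epi_of_isColimit_cofork (isColimitCoforkMapOfIsColimit G _ P.isColimit)

lemma exists_fac {b : B} (g : G.obj (ι.obj P.gen) ⟶ b)
    (hg : G.map (ι.map P.fst) ≫ g = G.map (ι.map P.snd) ≫ g) : ∃ l, G.map P.π ≫ l = g :=
  let h := isColimitCoforkMapOfIsColimit G _ P.isColimit
  ⟨Cofork.IsColimit.desc h g hg, Cofork.IsColimit.π_desc' h g hg⟩

end CoequalizerPresentation

section Comparison

variable {C : Type*} [Category* C] [MonoidalCategory C]
  {K A B : Type*} [Category* K] [Category* A] [Category* B]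
  [MonoidalLeftAction C K] [MonoidalLeftAction C A] [MonoidalLeftAction C B]
  (ι : K ⥤ A) (F : A ⥤ B) [ι.LeftLinear C] [(ι ⋙ F).LeftLinear C]

/-- The comparison of the actions on `A` and `B` at the objects in the image of `ι`. -/
def comparison (x : C) (k : K) : x ⊙ₗ F.obj (ι.obj k) ⟶ F.obj (x ⊙ₗ ι.obj k) :=
  μₗ (ι ⋙ F) x k ≫ F.map (δₗ ι x k)

lemma comparison_comp_map_μₗ (x : C) (k : K) :
    comparison ι F x k ≫ F.map (μₗ ι x k) = μₗ (ι ⋙ F) x k := by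
  rw [comparison, Category.assoc, ← F.map_comp, δₗ_comp_μₗ, F.map_id]
  exact Category.comp_id _

instance (x : C) (k : K) : IsIso (comparison ι F x k) := by
  unfold comparison
  exact IsIso.comp_isIso

lemma comparison_naturality_right (x : C) {k k' : K} (f : k ⟶ k') :
    x ⊴ₗ F.map (ι.map f) ≫ comparison ι F x k' =
      comparison ι F x k ≫ F.map (x ⊴ₗ ι.map f) := by
  have h : x ⊴ₗ F.map (ι.map f) ≫ μₗ (ι ⋙ F) x k' = μₗ (ι ⋙ F) x k ≫ F.map (ι.map (x ⊴ₗ f)) :=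
    μₗ_naturality_right (ι ⋙ F) x f
  unfold comparison
  rw [reassoc_of% h, Category.assoc, ← F.map_comp, ← F.map_comp, δₗ_naturality_right]

lemma comparison_naturality_left {x y : C} (f : x ⟶ y) (k : K) :
    f ⊵ₗ F.obj (ι.obj k) ≫ comparison ι F y k =
      comparison ι F x k ≫ F.map (f ⊵ₗ ι.obj k) := by
  have h : f ⊵ₗ F.obj (ι.obj k) ≫ μₗ (ι ⋙ F) y k = μₗ (ι ⋙ F) x k ≫ F.map (ι.map (f ⊵ₗ k)) :=
    μₗ_naturality_left (ι ⋙ F) f k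
  unfold comparison
  rw [reassoc_of% h, Category.assoc, ← F.map_comp, ← F.map_comp, δₗ_naturality_left]

lemma comparison_unitality (k : K) :
    comparison ι F (𝟙_ C) k ≫ F.map (λₗ (ι.obj k)).hom = (λₗ (F.obj (ι.obj k))).hom := by
  rw [comparison, Category.assoc, ← F.map_comp, δₗ_unitality_hom]
  exact (μₗ_unitality (ι ⋙ F) k).symm

/-- Since `y ▷ ι k` need not lie in the image of `ι`, no comparison is available there yet; the one
at `y ▷ k` is used instead, between the coherence morphisms. -/
lemma comparison_associativity (x y : C) (k : K) :
    comparison ι F (x ⊗ y) k ≫ F.map (αₗ x y (ι.obj k)).hom =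
      (αₗ x y (F.obj (ι.obj k))).hom ≫ x ⊴ₗ μₗ (ι ⋙ F) y k ≫
        comparison ι F x (y ⊙ₗ k) ≫ F.map (x ⊴ₗ δₗ ι y k) := by
  have h := μₗ_associativity_assoc (ι ⋙ F) x y k
    (F.map (δₗ ι x (y ⊙ₗ k)) ≫ F.map (x ⊴ₗ δₗ ι y k))
  simp only [comparison, Category.assoc, ← F.map_comp]
  rw [δₗ_associativity]
  simp only [Functor.comp_map, ← F.map_comp] at h
  exact h

/-- The comparison extends from the objects in the image of `ι` to a family of morphisms
`x ▷ F a ⟶ F (x ▷ a)` natural in `a`. -/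
lemma exists_comparison_extension [ι.Full]
    (P : ∀ a : A, CoequalizerPresentation ι a)
    (hP : ∀ {a b : A} (g : a ⟶ b), ∃ f, ι.map f ≫ (P b).π = (P a).π ≫ g)
    [∀ x : C, PreservesColimitsOfShape WalkingParallelPair (actionLeft B x)]
    [PreservesColimitsOfShape WalkingParallelPair F] :
    ∃ ψ : ∀ (x : C) (a : A), x ⊙ₗ F.obj a ⟶ F.obj (x ⊙ₗ a),
      (∀ x k, ψ x (ι.obj k) = comparison ι F x k) ∧
      ∀ (x : C) {a b : A} (g : a ⟶ b), x ⊴ₗ F.map g ≫ ψ x b = ψ x a ≫ F.map (x ⊴ₗ g) := by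
  have hepi (x : C) (a : A) : Epi (x ⊴ₗ F.map (P a).π) :=
    (P a).epi_map_π (F ⋙ actionLeft B x)
  -- Naturality of the comparison along the two relations makes it descend to the coequaliser.
  have h (x : C) (a : A) : ∃ ψ : x ⊙ₗ F.obj a ⟶ F.obj (x ⊙ₗ a),
      x ⊴ₗ F.map (P a).π ≫ ψ = comparison ι F x (P a).gen ≫ F.map (x ⊴ₗ (P a).π) := by
    refine (P a).exists_fac (F ⋙ actionLeft B x) _ ?_
    change x ⊴ₗ F.map (ι.map (P a).fst) ≫ _ = x ⊴ₗ F.map (ι.map (P a).snd) ≫ _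
    rw [reassoc_of% comparison_naturality_right ι F, reassoc_of% comparison_naturality_right ι F, ← F.map_comp,
      ← F.map_comp, ← actionHomRight_comp, ← actionHomRight_comp, (P a).condition]
  choose ψ hψ using h
  have hnat (x : C) {a b : A} (g : a ⟶ b) :
      x ⊴ₗ F.map g ≫ ψ x b = ψ x a ≫ F.map (x ⊴ₗ g) := by
    obtain ⟨f, hf⟩ := hP g
    rw [← cancel_epi (x ⊴ₗ F.map (P a).π), reassoc_of% hψ, ← F.map_comp, ← actionHomRight_comp,
      ← hf, actionHomRight_comp, F.map_comp, ← reassoc_of% comparison_naturality_right ι F, ← hψ,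
      ← actionHomRight_comp_assoc, ← actionHomRight_comp_assoc, ← F.map_comp, ← F.map_comp, hf]
  refine ⟨ψ, fun x k => ?_, hnat⟩
  -- By fullness the presentation of `ι k` comes from a morphism of `K`, along which the comparison
  -- is natural, so the descended map is the comparison itself.
  obtain ⟨f, hf⟩ := ι.map_surjective (P (ι.obj k)).π
  rw [← cancel_epi (x ⊴ₗ F.map (P (ι.obj k)).π), hψ, ← hf, comparison_naturality_right]

-- The oplax part is inverse to the lax part, hence determined by it.
variable {F} in
lemma leftLinear_ext {S S' : F.LeftLinear C}
    (h : ∀ x a, S.toLaxLeftLinear.μₗ x a = S'.toLaxLeftLinear.μₗ x a) : S = S' := by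
  have h' : S.toLaxLeftLinear = S'.toLaxLeftLinear := by
    cases hS : S.toLaxLeftLinear
    cases hS' : S'.toLaxLeftLinear
    rw [hS, hS'] at h
    obtain rfl := funext fun x => funext (h x)
    rfl
  have h'' : S.toOplaxLeftLinear = S'.toOplaxLeftLinear := by
    have e (x a) : S.toOplaxLeftLinear.δₗ x a = S'.toOplaxLeftLinear.δₗ x a := by
      have e₁ : S.toLaxLeftLinear.μₗ x a ≫ S.toOplaxLeftLinear.δₗ x a = 𝟙 _ := S.μₗ_comp_δₗ x a
      have e₂ : S'.toOplaxLeftLinear.δₗ x a ≫ S'.toLaxLeftLinear.μₗ x a = 𝟙 _ :=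
        S'.δₗ_comp_μₗ x a
      rw [← h] at e₂
      rw [← Category.id_comp (S.toOplaxLeftLinear.δₗ x a), ← e₂, Category.assoc, e₁,
        Category.comp_id]
    cases hS : S.toOplaxLeftLinear
    cases hS' : S'.toOplaxLeftLinear
    rw [hS, hS'] at e
    obtain rfl := funext fun x => funext (e x)
    rfl
  cases S
  cases S'
  subst h'
  subst h''
  rfl

/-- Two actions which agree on a full subcategory of generators `ι` agree: if every object of `A`
is functorially a coequaliser of objects in the image of `ι`, then a strong module structure on
`ι ⋙ F` is induced by exactly one strong module structure on `F`. -/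
theorem existsUnique_leftLinear [ι.Full]
    (P : ∀ a : A, CoequalizerPresentation ι a)
    (hP : ∀ {a b : A} (g : a ⟶ b), ∃ f, ι.map f ≫ (P b).π = (P a).π ≫ g)
    [∀ x : C, PreservesColimitsOfShape WalkingParallelPair (actionLeft A x)]
    [∀ x : C, PreservesColimitsOfShape WalkingParallelPair (actionLeft B x)]
    [PreservesColimitsOfShape WalkingParallelPair F] :
    ∃! S : F.LeftLinear C, ∀ (x : C) (k : K),
      S.toLaxLeftLinear.μₗ x (ι.obj k) ≫ F.map (μₗ ι x k) = μₗ (ι ⋙ F) x k := by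
  obtain ⟨ψ, hψ, hnat⟩ := exists_comparison_extension ι F (C := C) P hP
  have hepi (x : C) (a : A) : Epi (x ⊴ₗ F.map (P a).π) :=
    (P a).epi_map_π (F ⋙ actionLeft B x)
  have hepi' (x : C) (a : A) : Epi (F.map (x ⊴ₗ (P a).π)) :=
    (P a).epi_map_π (actionLeft A x ⋙ F)
  have hπ (x : C) (a : A) :
      x ⊴ₗ F.map (P a).π ≫ ψ x a = comparison ι F x (P a).gen ≫ F.map (x ⊴ₗ (P a).π) := by
    rw [hnat, hψ]
  -- Associativity is obtained first on the image of `ι`. Naturality of `ψ` along the isomorphism `y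
  -- ▷ ι k ≅ ι (y ▷ k)` computes it at `y ▷ ι k`.
  have hassoc (x y : C) (k : K) : ψ (x ⊗ y) (ι.obj k) ≫ F.map (αₗ x y (ι.obj k)).hom =
      (αₗ x y (F.obj (ι.obj k))).hom ≫ x ⊴ₗ ψ y (ι.obj k) ≫ ψ x (y ⊙ₗ ι.obj k) := by
    have e : ψ x (y ⊙ₗ ι.obj k) = x ⊴ₗ F.map (μₗ ι y k) ≫ comparison ι F x (y ⊙ₗ k) ≫
        F.map (x ⊴ₗ δₗ ι y k) := by
      rw [← hψ, ← hnat, ← actionHomRight_comp_assoc, ← F.map_comp, μₗ_comp_δₗ, F.map_id,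
        actionHomRight_id, Category.id_comp]
    rw [e, hψ, hψ, comparison_associativity, ← actionHomRight_comp_assoc,
      comparison_comp_map_μₗ]
  have hiso (x : C) (a : A) : IsIso (ψ x a) := by
    -- The inverse comparison descends in the same way, now because the action on `A` followed by
    -- `F` preserves the coequaliser.
    obtain ⟨θ, hθ⟩ : ∃ θ : F.obj (x ⊙ₗ a) ⟶ x ⊙ₗ F.obj a, F.map (x ⊴ₗ (P a).π) ≫ θ =
        inv (comparison ι F x (P a).gen) ≫ x ⊴ₗ F.map (P a).π :=
      (P a).exists_fac (actionLeft A x ⋙ F) _ (by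
        change F.map (x ⊴ₗ ι.map (P a).fst) ≫ _ = F.map (x ⊴ₗ ι.map (P a).snd) ≫ _
        rw [← cancel_epi (comparison ι F x (P a).rel),
          ← reassoc_of% comparison_naturality_right ι F, ← reassoc_of% comparison_naturality_right ι F,
          IsIso.hom_inv_id_assoc, ← actionHomRight_comp,
          ← actionHomRight_comp, ← F.map_comp, ← F.map_comp, (P a).condition])
    refine ⟨θ, ?_, ?_⟩
    · rw [← cancel_epi (x ⊴ₗ F.map (P a).π), reassoc_of% hπ, hθ, IsIso.hom_inv_id_assoc,
        Category.comp_id]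
    · rw [← cancel_epi (F.map (x ⊴ₗ (P a).π)), reassoc_of% hθ, hπ, IsIso.inv_hom_id_assoc,
        Category.comp_id]
  let L : F.LaxLeftLinear C :=
    { μₗ := ψ
      μₗ_naturality_left {x y} f a := by
        rw [← cancel_epi (x ⊴ₗ F.map (P a).π), action_exchange_assoc, hπ,
          reassoc_of% comparison_naturality_left ι F, reassoc_of% hπ, ← F.map_comp, ← F.map_comp,
          action_exchange]
      μₗ_naturality_right x _ _ g := hnat x g
      μₗ_associativity x y a := by
        rw [← cancel_epi ((x ⊗ y) ⊴ₗ F.map (P a).π), reassoc_of% hπ, ← F.map_comp]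
        have e₁ : ((x ⊗ y) ⊴ₗ (P a).π) ≫ (αₗ x y a).hom =
          (αₗ x y (ι.obj (P a).gen)).hom ≫ x ⊴ₗ y ⊴ₗ (P a).π := by simp
        rw [e₁, F.map_comp, ← hψ, reassoc_of% hassoc, tensor_actionHomRight, Category.assoc,
          Category.assoc, Iso.inv_hom_id_assoc, ← actionHomRight_comp_assoc, hnat,
          actionHomRight_comp_assoc, hnat]
      μₗ_unitality a := by
        rw [← cancel_epi ((𝟙_ C) ⊴ₗ F.map (P a).π), reassoc_of% hπ, ← F.map_comp,
          ← actionUnitIso_hom_naturality, ← actionUnitIso_hom_naturality, F.map_comp,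
          reassoc_of% comparison_unitality ι F] }
  have hL (x a) : IsIso (L.μₗ x a) := hiso x a
  refine ⟨leftLinearOfIsIso F, fun x k => ?_, fun S hS => leftLinear_ext fun x a => ?_⟩
  · exact (congrArg (· ≫ _) (hψ x k)).trans (comparison_comp_map_μₗ ι F x k)
  -- The coherence of `ι` is invertible, so the prescribed composite fixes `S` on generators;
  -- naturality along the epimorphism from the generators then fixes it everywhere.
  · have e : S.toLaxLeftLinear.μₗ x (ι.obj (P a).gen) = comparison ι F x (P a).gen := by
      rw [← cancel_mono (F.map (μₗ ι x (P a).gen)), hS, comparison_comp_map_μₗ]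
    rw [← cancel_epi (x ⊴ₗ F.map (P a).π), S.toLaxLeftLinear.μₗ_naturality_right, e]
    exact (hπ x a).symm

end Comparison

/-! ### Algebras as coequalisers of free algebras. -/

section Algebras

variable {M : Type*} [Category* M] (T : Monad M)

instance embedding_full : (embedding T).Full where
  map_surjective {m n} q := by
    refine ⟨Kleisli.Hom.mk (freeRestrict (n := T.free.obj n.of) q), ?_⟩
    exact freeDesc_freeRestrict (n := T.free.obj n.of) q

lemma embedding_map_pureHom {m n : M} (f : m ⟶ n) :
    (embedding T).map (pureHom T f) = T.free.map f := by
  ext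
  change T.map (f ≫ T.η.app n) ≫ T.μ.app n = T.map f
  rw [Functor.map_comp, Category.assoc, T.right_unit]
  exact Category.comp_id _

/-- Every algebra is a coequaliser of free algebras. -/
def freePresentation (a : T.Algebra) : CoequalizerPresentation (embedding T) a where
  rel := Kleisli.mk T (T.obj a.A)
  gen := Kleisli.mk T a.A
  fst := pureHom T a.a
  -- The identity of `T a`, read as a Kleisli morphism from `T a` to `a`, is sent by `ι` to the
  -- multiplication.
  snd := Kleisli.Hom.mk (𝟙 (T.obj a.A))
  π := algebraCounit T a
  condition := by
    rw [embedding_map_pureHom]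
    ext
    change T.map a.a ≫ a.a = (T.map (𝟙 _) ≫ T.μ.app a.A) ≫ a.a
    rw [CategoryTheory.Functor.map_id, Category.id_comp, a.assoc]
  isColimit := Cofork.IsColimit.mk' _ fun s => by
    have hs : T.free.map a.a ≫ s.π = (embedding T).map (Kleisli.Hom.mk (𝟙 (T.obj a.A))) ≫ s.π :=
      (congrArg (· ≫ s.π) (embedding_map_pureHom T a.a).symm).trans s.condition
    have h : a.a ≫ freeRestrict s.π = freeMap s.π := by
      refine (freeRestrict_map_comp _ _).symm.trans ((congrArg freeRestrict hs).trans ?_)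
      refine (freeRestrict_comp _ _).trans ?_
      refine (congrArg (· ≫ freeMap s.π)
        (freeRestrict_freeDesc (n := T.free.obj a.A) (𝟙 (T.obj a.A)))).trans ?_
      exact Category.id_comp _
    refine ⟨{ f := freeRestrict s.π, h := (map_freeRestrict_comp_a s.π).trans h.symm }, ?_,
      fun {m} hm => ?_⟩
    · apply freeHom_ext
      refine (freeRestrict_comp (algebraCounit T a) _).trans ?_
      rw [freeRestrict_algebraCounit]
      exact Category.id_comp _
    · ext
      refine Eq.trans ?_ (congrArg freeRestrict hm)
      refine Eq.trans ?_ (freeRestrict_comp (algebraCounit T a) m).symm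
      rw [freeRestrict_algebraCounit]
      exact (Category.id_comp _).symm

end Algebras

/-! ### Finite colimits of algebras over a right exact monad. -/

section RightExact

variable {M : Type*} [Category* M] [HasFiniteColimits M] (T : Monad M)
  [PreservesFiniteColimits T.toFunctor]

/-- As `T` preserves finite colimits, the forgetful functor creates them, and it preserves them
because they exist in `M`. -/
instance preservesFiniteColimits_forget : PreservesFiniteColimits T.forget :=
  ⟨fun _ _ _ => inferInstance⟩

instance hasCoequalizers_algebra : HasCoequalizers T.Algebra :=
  hasColimitsOfShape_of_hasColimitsOfShape_createsColimitsOfShape T.forget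

end RightExact

end ModuleMonad

open ModuleMonad in
theorem mainTheorem9 (k : Type*) [Field k]
    (C : Type*) [Category* C] [Abelian C] [Linear k C]
    [MonoidalCategory C] [MonoidalPreadditive C] [MonoidalLinear k C]
    (M : Type*) [Category* M] [Abelian M] [Linear k M]
    [MonoidalLeftAction C M] [BilinearAction k C M]
    (hleft : ∀ x : C, PreservesFiniteColimits (MonoidalLeftAction.actionLeft M x))
    (hright : ∀ m : M, PreservesFiniteColimits (MonoidalLeftAction.actionRight (C := C) m))
    (T : Monad M) [T.toFunctor.Additive] [T.toFunctor.Linear k]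
    [PreservesFiniteColimits T.toFunctor]
    [T.toFunctor.LaxLeftLinear C] [LaxModuleMonad C T] :
    (∃ E : Extension C T, E.IsLinton ∧ E.Bilinear k ∧ E.RightExact) ∧
    (∀ E₁ E₂ : Extension C T, E₁.RightExact → E₂.RightExact →
      ∃! S : Extension.IdentityStrong E₁ E₂, ∀ (x : C) (m : Kleisli T),
        Extension.IdentityStrong.hom S x ((embedding T).obj m) ≫ E₁.coherence x m =
          E₂.coherence x m) := by
  constructor
  · refine ⟨lintonExtension C T, isLinton_lintonExtension T, bilinear_lintonExtension T k,
      fun x => ⟨fun J _ _ => ?_⟩⟩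
    exact preservesColimitsOfShape_actionLeft T x J
  · intro E₁ E₂ h₁ h₂
    have hP {a b : T.Algebra} (g : a ⟶ b) : ∃ f, (embedding T).map f ≫ (freePresentation T b).π =
        (freePresentation T a).π ≫ g :=
      ⟨pureHom T g.f, (congrArg (· ≫ algebraCounit T b) (embedding_map_pureHom T g.f)).trans
        (Monad.Algebra.Hom.ext g.h)⟩
    -- Source and target are the same category with two different actions; the second structure on
    -- `ι` serves as the structure on `ι ⋙ 𝟭`.
    exact @existsUnique_leftLinear C _ _ (Kleisli T) T.Algebra T.Algebra _ _ _ _ E₁.action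
      E₂.action (embedding T) (𝟭 T.Algebra) E₁.strong E₂.strong _ (freePresentation T) hP
      (fun x => (h₁ x).preservesFiniteColimits _)
      (fun x => (h₂ x).preservesFiniteColimits _) inferInstance
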